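/- **Setting.** Let $D\ge 1$, and let $\Lambda=(\mathbb Z/L\mathbb Z)^D$ be the cubic lattice of linear size $L\ge 1$ with periodic boundary conditions. Each site $u$ carries a Hilbert space $\mathbb C^{d_u}$, and $\mathcal H=\bigotimes_{u\in\Lambda}\mathbb C^{d_u}$. For $1\le r\le L$ let $\mathcal S(r)$ be the set of all cubes in $\Lambda$ of linear size $r$ (so $\mathcal S(L)=\{\Lambda\}$), and put $\mathcal S(r)=\emptyset$ for $r>L$. Let $H_0=\sum_{A\in\mathcal S(2)}Q_A$, where the $Q_A$ are pairwise commuting orthogonal projectors and $Q_A$ acts on $A$. Put $P_B=\prod_{A\in\mathcal S(2),\,A\subseteq B}(I-Q_A)$ and $P=P_\Lambda$, and assume $P\neq 0$ (the ground state energy of $H_0$ is zero). Let $L^*$ be an integer with $L^*\ge L^a$, where $a>0$, such that * (TQO-1) for every $A\in\mathcal S(r)$ with $r\le L^*$ and every operator $O$ acting on $A$, $POP=cP$ for some $c\in\mathbb C$; * (TQO-2) for every $A\in\mathcal S(r)$ with $r\le L^*$ and $r+2\le L$, and every operator $O$ acting on $A$ with $OP=0$, one has $OP_B=0$, where $B\in\mathcal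 S(r+2)$ is the cube formed by $A$ and all its nearest neighbors. Let $V=\sum_{r\ge1}\sum_{A\in\mathcal S(r)}V_{r,A}$, where $V_{r,A}$ is Hermitian and acts on $A$. Assume that $V$ is locally block-diagonal, i.e. $[V_{r,A},P]=0$ for all $r,A$, and that it has strength $J\ge0$, i.e. $\|V_{r,A}\|\le J f(r)$ for all $r\ge 1$ and $A\in\mathcal S(r)$, where $f:\{1,2,\dots\}\to[0,1]$ decays faster than any power. **Lemma.** Up to an overall energy shift, the spectrum of $H_0+V$ is contained in $\bigcup_k I_k$, where $k$ runs over the spectrum of $H_0$ and $$I_k=[\,k(1-b)-\delta,\;k(1+b)+\delta\,],\qquad b=CJ,\quad \delta=J\,g(L^*).$$ That is, there is $c\in\mathbb R$ such that the spectrum of $H_0+V+cI$ is contained in $\bigcup_k I_k$. Here $C>0$ depends only on $D$ and $f$, and the function $g\ge 0$, which decays faster than any power, depends only on $D$, $f$ and $a$. In particular $C$ and $g$ do not depend on $L$, $L^*$, the dimensions $d_u$, $H_0$, $V$ or $J$. -/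

import Mathlib

open scoped Matrix.Norms.L2Operator

namespace LatticeTQO

/-- Sites of the `D`-dimensional cubic lattice of linear size `L` with periodic boundary
conditions. -/
abbrev Site (D L : ℕ) : Type := Fin D → ZMod L

/-- The cube of linear size `r` with lowest corner `u`: the sites `u + x` with
`x i ∈ {0, …, r - 1}` for every coordinate `i`. -/
def cube {D L : ℕ} [NeZero L] (r : ℕ) (u : Site D L) : Finset (Site D L) :=
  Finset.univ.filter fun v => ∀ i, (v i - u i).val < r

/-- The set `S(r)` of all cubes of linear size `r`. For `1 ≤ r < L` it consists of the `L ^ D`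
translates of one cube, `S(L)` has the whole lattice as its only element, and there are no cubes of
size `r > L`. -/
def cubes (D L : ℕ) [NeZero L] (r : ℕ) : Finset (Finset (Site D L)) :=
  if 1 ≤ r ∧ r ≤ L then Finset.univ.image (cube r) else ∅

/-- The product basis of `⨂ u, ℂ ^ (d u)`. -/
abbrev Config {D L : ℕ} (d : Site D L → ℕ) : Type := ∀ u : Site D L, Fin (d u)

/-- Linear operators on the Hilbert space `⨂ u, ℂ ^ (d u)`, as matrices in the product basis. The
norm on this space is the operator norm for the Hilbert space norm. -/
abbrev Op {D L : ℕ} (d : Site D L → ℕ) : Type := Matrix (Config d) (Config d) ℂ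

/-- `O` acts (non-trivially only) on the sites of `A`: it has the form `M ⊗ 1` with `M` an
operator on `⨂ u ∈ A, ℂ ^ (d u)` and `1` the identity on the other sites. -/
def ActsOn {D L : ℕ} [NeZero L] {d : Site D L → ℕ} (A : Finset (Site D L)) (O : Op d) : Prop :=
  ∃ M : Matrix (∀ u : {u // u ∈ A}, Fin (d u)) (∀ u : {u // u ∈ A}, Fin (d u)) ℂ,
    ∀ σ τ : Config d,
      O σ τ = if ∀ u, u ∉ A → σ u = τ u then M (fun u => σ u) (fun u => τ u) else 0

/-- Pairwise commuting orthogonal projectors `Q_A`, one for each cube `A` of size `2`, with `Q_A`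
acting on `A`. (The values of `Q` at other sets of sites are never used.) -/
structure ProjectorModel (D L : ℕ) [NeZero L] (d : Site D L → ℕ) where
  Q : Finset (Site D L) → Op d
  isStarProjection : ∀ A ∈ cubes D L 2, IsStarProjection (Q A)
  actsOn : ∀ A ∈ cubes D L 2, ActsOn A (Q A)
  commute : ∀ A ∈ cubes D L 2, ∀ B ∈ cubes D L 2, Commute (Q A) (Q B)

namespace ProjectorModel

variable {D L : ℕ} [NeZero L] {d : Site D L → ℕ} (M : ProjectorModel D L d)

/-- The unperturbed Hamiltonian `H₀ = ∑_{A ∈ S(2)} Q_A`. -/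
noncomputable def H₀ : Op d := ∑ A ∈ cubes D L 2, M.Q A

/-- The local ground projector `P_B`, the product of `1 - Q_A` over all `A ∈ S(2)` with `A ⊆ B`. -/
noncomputable def localProj (B : Finset (Site D L)) : Op d :=
  ((cubes D L 2).filter (· ⊆ B)).noncommProd (fun A => 1 - M.Q A) (by
    intro A hA C hC _
    have h := M.commute A (Finset.mem_filter.1 hA).1 C (Finset.mem_filter.1 hC).1
    exact ((Commute.one_left _).sub_left ((Commute.one_right _).sub_right h)))

/-- The projector `P` onto the joint kernel of all `Q_A`: the product of `1 - Q_A` over all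
`A ∈ S(2)`. -/
noncomputable def P : Op d := M.localProj Finset.univ

/-- The ground state energy of `H₀` is zero: some non-zero vector is annihilated by every `Q_A`. -/
def ZeroGroundEnergy : Prop := M.P ≠ 0

/-- Operators acting on a cube of size at most `ℓ` act on the ground subspace as scalars. -/
def TQO1 (ℓ : ℕ) : Prop :=
  ∀ r ≤ ℓ, ∀ A ∈ cubes D L r, ∀ O : Op d, ActsOn A O → ∃ c : ℂ, M.P * O * M.P = c • M.P

/-- An operator acting on a cube `A` of size `r ≤ ℓ` that annihilates the ground subspace
annihilates the local ground subspace of the cube of size `r + 2` formed by `A` and all its nearest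
neighbors. -/
def TQO2 (ℓ : ℕ) : Prop :=
  ∀ r : ℕ, 1 ≤ r → r ≤ ℓ → r + 2 ≤ L → ∀ u : Site D L, ∀ O : Op d, ActsOn (cube r u) O →
    O * M.P = 0 → O * M.localProj (cube (r + 2) (fun i => u i - 1)) = 0

end ProjectorModel

/-- A Hamiltonian given by a decomposition into Hermitian terms `V_{r,A}`, `A ∈ S(r)`, with
`V_{r,A}` acting on `A`. (The values of `term` elsewhere are never used.) -/
structure LocalHamiltonian (D L : ℕ) [NeZero L] (d : Site D L → ℕ) where
  term : ℕ → Finset (Site D L) → Op d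
  isHermitian : ∀ r, ∀ A ∈ cubes D L r, (term r A).IsHermitian
  actsOn : ∀ r, ∀ A ∈ cubes D L r, ActsOn A (term r A)

namespace LocalHamiltonian

variable {D L : ℕ} [NeZero L] {d : Site D L → ℕ} (V : LocalHamiltonian D L d)

/-- The operator `V = ∑_{r ≥ 1} ∑_{A ∈ S(r)} V_{r,A}`; there are no terms with `r > L`. -/
noncomputable def total : Op d := ∑ r ∈ Finset.Icc 1 L, ∑ A ∈ cubes D L r, V.term r A

/-- `V` has strength `J` with decay function `f`: `‖V_{r,A}‖ ≤ J f(r)`. -/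
def HasStrength (f : ℕ → ℝ) (J : ℝ) : Prop :=
  ∀ r, ∀ A ∈ cubes D L r, ‖V.term r A‖ ≤ J * f r

/-- Every term of the decomposition preserves the ground subspace. -/
def LocallyBlockDiagonal (M : ProjectorModel D L d) : Prop :=
  ∀ r, ∀ A ∈ cubes D L r, Commute (V.term r A) M.P

end LocalHamiltonian

/-- `f(n)` decays faster than any power of `n`. -/
def FastDecay (f : ℕ → ℝ) : Prop :=
  Asymptotics.SuperpolynomialDecay Filter.atTop (fun n : ℕ => (n : ℝ)) f

end LatticeTQO

/-! The perturbation is sandwiched between multiples of `H₀`, up to a scalar and a small error. By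
TQO-1 and block-diagonality a term on a small cube is a real scalar on the ground space. Subtracting
it gives `W` with `W * P = 0`, and TQO-2 localizes this to `W * P_B = 0` on the enlarged cube `B`.
Hence `±W ≤ ‖W‖ (1 - P_B) ≤ ‖W‖ ∑_{C ⊆ B} Q_C`. A given `C` lies in at most `(r + 2) ^ D` of the
cubes `B`, so all terms of size `r` together are at most `2 J f(r) (r + 2) ^ D H₀`
(`LocalHamiltonian.exists_sum_term_bounds`), which is summable in `r`.

Terms larger than `Lstar` are bounded in norm (`LocalHamiltonian.norm_sum_term_le`); their number
costs a factor `L ^ D`, polynomial in `Lstar` and so absorbed by the fast tail.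
`spectrum_subset_of_le_of_le` turns the sandwich into spectral intervals. -/

namespace LatticeTQO

open scoped Matrix MatrixOrder ComplexOrder

/-! ### Operator inequalities for projections -/

section CStar

variable {A ι : Type*} [CStarAlgebra A] [PartialOrder A] [StarOrderedRing A]

/-- The product `p` of the complements of commuting projections is a projection, and `1 - p` is
bounded by the sum of the projections. -/
theorem noncommProd_one_sub_isStarProjection_and_le [DecidableEq ι] (q : ι → A) (s : Finset ι)
    (hq : ∀ i ∈ s, IsStarProjection (q i)) (hc : ∀ i ∈ s, ∀ j ∈ s, Commute (q i) (q j)) :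
    ∀ comm, IsStarProjection (s.noncommProd (fun i => 1 - q i) comm) ∧
      1 - s.noncommProd (fun i => 1 - q i) comm ≤ ∑ i ∈ s, q i := by
  induction s using Finset.induction_on with
  | empty => intro _; simp [IsStarProjection.one]
  | insert a s ha ih =>
    intro comm
    rw [Finset.noncommProd_insert_of_notMem _ _ _ _ ha, Finset.sum_insert ha]
    obtain ⟨h1, h2⟩ := ih (fun i hi => hq i (Finset.mem_insert_of_mem hi))
      (fun i hi j hj => hc i (Finset.mem_insert_of_mem hi) j (Finset.mem_insert_of_mem hj))
      (comm.mono fun _ => Finset.mem_insert_of_mem)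
    have hcomm : Commute (q a) (s.noncommProd (fun i => 1 - q i)
        (comm.mono fun _ => Finset.mem_insert_of_mem)) :=
      Finset.noncommProd_commute _ _ _ _ fun i hi => (Commute.one_right _).sub_right
        (hc a (Finset.mem_insert_self _ _) i (Finset.mem_insert_of_mem hi))
    set p := s.noncommProd (fun i => 1 - q i) (comm.mono fun _ => Finset.mem_insert_of_mem)
    have hqa := hq a (Finset.mem_insert_self _ _)
    refine ⟨hqa.one_sub.mul h1 ((Commute.one_left _).sub_left hcomm), ?_⟩
    -- A product of commuting projections is a projection; this is the term dropped below.
    have h3 : 0 ≤ q a * (1 - p) :=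
      (hqa.mul h1.one_sub ((Commute.one_right _).sub_right hcomm)).nonneg
    have h4 : 1 - (1 - q a) * p = q a + (1 - p) - q a * (1 - p) := by noncomm_ring
    rw [h4]
    exact (sub_le_self _ h3).trans (add_le_add_right h2 _)

/-- A self-adjoint element annihilated by a projection `p` is bounded by a multiple of `1 - p`. -/
theorem IsSelfAdjoint.le_norm_smul_one_sub {x p : A} (hx : IsSelfAdjoint x)
    (hp : IsStarProjection p) (hxp : x * p = 0) : x ≤ ‖x‖ • (1 - p) := by
  have hpx : p * x = 0 := by
    have := congrArg star hxp
    simpa [hx.star_eq, hp.isSelfAdjoint.star_eq] using this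
  -- Since `x = (1 - p) x (1 - p)`, it suffices to compress `x ≤ ‖x‖` by `1 - p`.
  have h := star_left_conjugate_le_conjugate hx.le_algebraMap_norm_self (1 - p)
  have e1 : star (1 - p) * x * (1 - p) = x := by
    rw [hp.one_sub.isSelfAdjoint.star_eq]
    simp [sub_mul, mul_sub, hpx, hxp]
  have e2 : star (1 - p) * algebraMap ℝ A ‖x‖ * (1 - p) = ‖x‖ • (1 - p) := by
    rw [hp.one_sub.isSelfAdjoint.star_eq, Algebra.algebraMap_eq_smul_one, mul_smul_comm, mul_one,
      smul_mul_assoc, hp.one_sub.isIdempotentElem.eq]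
  rwa [e1, e2] at h

end CStar

/-- If `(1 - b) H - δ ≤ X ≤ (1 + b) H + δ` with `H ≥ 0`, then every eigenvalue of `X` is within
`b k + δ` of an eigenvalue `k` of `H`. -/
theorem spectrum_subset_of_le_of_le {n : Type*} [Fintype n] [DecidableEq n] {H X : Matrix n n ℂ}
    (hH : H.IsHermitian) (hX : X.IsHermitian) {b δ : ℝ}
    (hlo : (1 - b) • H - δ • (1 : Matrix n n ℂ) ≤ X)
    (hhi : X ≤ (1 + b) • H + δ • (1 : Matrix n n ℂ)) :
    spectrum ℝ X ⊆ ⋃ k ∈ spectrum ℝ H, Set.Icc (k * (1 - b) - δ) (k * (1 + b) + δ) := by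
  intro l hl
  by_contra hcon
  simp only [Set.mem_iUnion, Set.mem_Icc, not_exists, not_and, not_le] at hcon
  have hHs : IsSelfAdjoint H := hH
  have hct : ∀ φ : ℝ → ℝ, ContinuousOn φ (spectrum ℝ H) := fun φ =>
    (Matrix.finite_real_spectrum (A := H)).continuousOn φ
  set Y : Matrix n n ℂ := X - l • 1 with hY
  have hYs : Yᴴ = Y := by
    simp [hY, Matrix.conjTranspose_sub, hX.eq, Matrix.conjTranspose_smul]
  obtain ⟨v, hv0, hv⟩ : ∃ v : n → ℂ, v ≠ 0 ∧ Y *ᵥ v = 0 := by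
    rw [Matrix.exists_mulVec_eq_zero_iff]
    by_contra hdet
    refine hl (spectrum.mem_resolventSet_iff.2 ?_)
    have hu : IsUnit Y := (Matrix.isUnit_iff_isUnit_det _).2 (Ne.isUnit hdet)
    have : algebraMap ℝ (Matrix n n ℂ) l - X = -Y := by
      rw [hY, Algebra.algebraMap_eq_smul_one]; abel
    rw [this]
    exact hu.neg
  -- `φ` selects the eigenvalues of `H` whose interval lies below `l`; for the others the lower
  -- endpoint exceeds `l`. Thus `Y` compressed to the range of `e` is negative, and compressed to
  -- that of `e'` positive.
  let φ : ℝ → ℝ := fun k => if k * (1 + b) + δ < l then 1 else 0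
  set e := cfc φ H with he
  set e' := cfc (fun k => 1 - φ k) H with he'
  have hes : star e = e := (cfc_predicate φ H : IsSelfAdjoint _)
  have hes' : star e' = e' := (cfc_predicate (fun k => 1 - φ k) H : IsSelfAdjoint _)
  have hee : e' = 1 - e := by
    rw [he', cfc_sub (fun _ => (1 : ℝ)) φ H (hct _) (hct _), cfc_const_one ℝ H]
  have haff : ∀ s t : ℝ, s • H + t • (1 : Matrix n n ℂ) = cfc (fun k => s * k + t) H := by
    intro s t
    rw [cfc_add (a := H) (fun k => s * k) (fun _ => t) (hct _) (hct _),
      cfc_const_mul_id s H, cfc_const t H, Algebra.algebraMap_eq_smul_one]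
  have h1 : e * Y * e ≤ cfc (fun k => φ k * ((1 + b) * k + (δ - l)) * φ k) H := by
    rw [cfc_mul (a := H) _ φ (hct _) (hct _), cfc_mul (a := H) φ _ (hct _) (hct _), ← haff]
    have := star_left_conjugate_le_conjugate (sub_le_sub_right hhi (l • (1 : Matrix n n ℂ))) e
    rw [hes] at this
    rw [sub_smul δ l, ← add_sub_assoc]
    exact this
  have h2 : cfc (fun k => (1 - φ k) * ((1 - b) * k + (-δ - l)) * (1 - φ k)) H ≤ e' * Y * e' := by
    rw [cfc_mul (a := H) _ (fun k => 1 - φ k) (hct _) (hct _),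
      cfc_mul (a := H) (fun k => 1 - φ k) _ (hct _) (hct _), ← haff]
    have := star_left_conjugate_le_conjugate (sub_le_sub_right hlo (l • (1 : Matrix n n ℂ))) e'
    rw [hes'] at this
    rw [sub_smul (-δ) l, ← add_sub_assoc, neg_smul, ← sub_eq_add_neg]
    exact this
  have h3 := sub_le_sub h2 h1
  rw [← cfc_sub (a := H) _ _ (hct _) (hct _)] at h3
  set h : ℝ → ℝ := fun k => (1 - φ k) * ((1 - b) * k + (-δ - l)) * (1 - φ k) -
    φ k * ((1 + b) * k + (δ - l)) * φ k with hh
  have hpos : ∀ k ∈ spectrum ℝ H, 0 < h k := by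
    intro k hk
    by_cases hk1 : k * (1 + b) + δ < l
    · simp only [hh, φ, if_pos hk1]; linarith
    · have := mt (hcon k hk) hk1
      simp only [hh, φ, if_neg hk1]; linarith
  have hpd : (cfc h H).PosDef := by
    rw [Matrix.PosSemidef.posDef_iff_isUnit
      (Matrix.nonneg_iff_posSemidef.1 (cfc_nonneg fun k hk => (hpos k hk).le))]
    exact (isUnit_cfc_iff h H (hct _)).2 fun k hk => (hpos k hk).ne'
  have hq : 0 < star v ⬝ᵥ ((e' * Y * e' - e * Y * e) *ᵥ v) := by
    have ha := hpd.dotProduct_mulVec_pos hv0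
    have hb := (Matrix.le_iff.1 h3).dotProduct_mulVec_nonneg v
    rw [Matrix.sub_mulVec, dotProduct_sub] at hb
    exact ha.trans_le (sub_nonneg.1 hb)
  -- The positive definite difference is an anticommutator with `Y`, so its expectation in the
  -- kernel vector `v` vanishes: a contradiction.
  have hN : (2 : ℂ) • (e' * Y * e' - e * Y * e) = (1 - 2 • e) * Y + Y * (1 - 2 • e) := by
    rw [hee, two_smul]; noncomm_ring
  have hvY : star v ᵥ* Y = 0 := by
    have := congrArg star hv
    rwa [Matrix.star_mulVec, hYs, star_zero] at this
  have hz : (2 : ℂ) * (star v ⬝ᵥ ((e' * Y * e' - e * Y * e) *ᵥ v)) = 0 := by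
    rw [← smul_eq_mul, ← dotProduct_smul, ← Matrix.smul_mulVec, hN, Matrix.add_mulVec,
      ← Matrix.mulVec_mulVec, hv, Matrix.mulVec_zero, zero_add, ← Matrix.mulVec_mulVec,
      Matrix.dotProduct_mulVec, hvY, zero_dotProduct]
  rw [mul_eq_zero_iff_left two_ne_zero] at hz
  exact hq.ne' hz

/-! ### Counting cubes on the torus -/

section Cubes

variable {D L : ℕ} [NeZero L]

theorem cube_eq_univ {r : ℕ} (h : L ≤ r) (u : Site D L) : cube r u = Finset.univ :=
  Finset.filter_true_of_mem fun _ _ _ => (ZMod.val_lt _).trans_le h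

theorem exists_eq_cube {r : ℕ} {A : Finset (Site D L)} (hA : A ∈ cubes D L r) :
    ∃ u, A = cube r u := by
  unfold cubes at hA
  split_ifs at hA
  · obtain ⟨u, -, h⟩ := Finset.mem_image.1 hA
    exact ⟨u, h.symm⟩
  · simp at hA

theorem nonempty_of_mem_cubes {r : ℕ} {A : Finset (Site D L)} (hA : A ∈ cubes D L r) :
    A.Nonempty := by
  have hr : 1 ≤ r := by
    by_contra h
    simp [cubes, h] at hA
  obtain ⟨u, rfl⟩ := exists_eq_cube hA
  exact ⟨u, by simpa [cube] using fun _ => Nat.pos_of_ne_zero (Nat.one_le_iff_ne_zero.1 hr)⟩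

theorem card_cubes_le (D L : ℕ) [NeZero L] (r : ℕ) : (cubes D L r).card ≤ L ^ D := by
  unfold cubes
  split_ifs
  · exact Finset.card_image_le.trans (by simp [ZMod.card])
  · simp

/-- A site lies in at most `s ^ D` of the cubes of size `s`. -/
theorem card_filter_mem_cube_le (s : ℕ) (w : Site D L) :
    (Finset.univ.filter fun u : Site D L => w ∈ cube s fun i => u i - 1).card ≤ s ^ D := by
  have hsub : (Finset.univ.filter fun u : Site D L => w ∈ cube s fun i => u i - 1) ⊆
      Fintype.piFinset fun i => Finset.univ.filter fun x : ZMod L => (w i - (x - 1)).val < s := by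
    intro u hu
    simpa [cube, Fintype.mem_piFinset] using hu
  refine (Finset.card_le_card hsub).trans ?_
  rw [Fintype.card_piFinset]
  calc _ ≤ ∏ _i : Fin D, s := Finset.prod_le_prod' fun i _ => by
        rw [← Finset.card_range s]
        refine Finset.card_le_card_of_injOn (fun x => (w i - (x - 1)).val) ?_ ?_
        · intro x hx
          simpa using hx
        · intro x _ y _ hxy
          simpa using ZMod.val_injective L hxy
    _ = s ^ D := by simp

end Cubes

/-! ### Small terms are bounded relative to `H₀` -/

variable {D L : ℕ} [NeZero L] {d : Site D L → ℕ}

theorem ActsOn.sub_smul_one {A : Finset (Site D L)} {O : Op d} (h : ActsOn A O) (c : ℂ) :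
    ActsOn A (O - c • 1) := by
  obtain ⟨M, hM⟩ := h
  refine ⟨M - c • 1, fun σ τ => ?_⟩
  have hστ : σ = τ ↔ (∀ u, u ∉ A → σ u = τ u) ∧
      (fun u : {u // u ∈ A} => σ u) = fun u : {u // u ∈ A} => τ u := by
    constructor
    · rintro rfl
      simp
    · rintro ⟨h1, h2⟩
      funext u
      by_cases hu : u ∈ A
      · exact congrFun h2 ⟨u, hu⟩
      · exact h1 u hu
  rw [Matrix.sub_apply, Matrix.smul_apply, hM, Matrix.one_apply]
  by_cases h1 : ∀ u, u ∉ A → σ u = τ u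
  · rw [if_pos h1, if_pos h1, Matrix.sub_apply, Matrix.smul_apply, Matrix.one_apply]
    simp only [hστ.trans (and_iff_right h1)]
  · rw [if_neg h1, if_neg h1, if_neg fun h => h1 (hστ.1 h).1]
    simp

namespace ProjectorModel

variable (M : ProjectorModel D L d)

theorem localProj_spec (B : Finset (Site D L)) :
    IsStarProjection (M.localProj B) ∧
      1 - M.localProj B ≤ ∑ A ∈ (cubes D L 2).filter (· ⊆ B), M.Q A :=
  noncommProd_one_sub_isStarProjection_and_le M.Q _
    (fun A hA => M.isStarProjection A (Finset.mem_filter.1 hA).1)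
    (fun A hA C hC => M.commute A (Finset.mem_filter.1 hA).1 C (Finset.mem_filter.1 hC).1) _

theorem isHermitian_H₀ : M.H₀.IsHermitian := by
  have : IsSelfAdjoint M.H₀ :=
    isSelfAdjoint_sum _ fun A hA => (M.isStarProjection A hA).isSelfAdjoint
  exact this

theorem H₀_nonneg : 0 ≤ M.H₀ :=
  Finset.sum_nonneg fun A hA => (M.isStarProjection A hA).nonneg

variable {M}

/-- A Hermitian operator that acts on a small cube and commutes with the ground projector is a
real scalar on the ground subspace, of modulus at most its norm. -/
theorem TQO1.exists_real_smul {ℓ r : ℕ} (h1 : M.TQO1 ℓ) (hP : M.ZeroGroundEnergy) (hr : r ≤ ℓ)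
    {A : Finset (Site D L)} (hA : A ∈ cubes D L r) {O : Op d} (hO : ActsOn A O)
    (hH : O.IsHermitian) (hc : Commute O M.P) :
    ∃ c : ℝ, |c| ≤ ‖O‖ ∧ (O - (c : ℂ) • 1) * M.P = 0 := by
  obtain ⟨c, h⟩ := h1 r hr A hA O hO
  have hPp : IsStarProjection M.P := (M.localProj_spec Finset.univ).1
  have hOP : O * M.P = c • M.P := by
    rw [← h, ← hc.eq, mul_assoc, hPp.isIdempotentElem.eq]
  -- Compare `P O P = c P` with its adjoint, using `P ≠ 0`.
  have hcr : star c = c := by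
    have h2 := congrArg star h
    have hO' : star O = O := hH
    rw [star_mul, star_mul, star_smul, hPp.isSelfAdjoint.star_eq, hO', ← mul_assoc, h] at h2
    exact (smul_left_injective ℂ hP h2).symm
  obtain ⟨x, rfl⟩ : ∃ x : ℝ, (x : ℂ) = c := Complex.conj_eq_iff_real.1 hcr |>.imp fun _ => Eq.symm
  refine ⟨x, ?_, by rw [sub_mul, hOP, smul_mul_assoc, one_mul, sub_self]⟩
  have hn := congrArg norm hOP
  rw [norm_smul, Complex.norm_real, Real.norm_eq_abs] at hn
  exact le_of_mul_le_mul_right (hn ▸ norm_mul_le _ _) (norm_pos_iff.2 hP)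

/-- When `r + 2 > L` the enlarged cube wraps around to the whole lattice and its local projector is
`P` itself, so the size restriction in TQO-2 is harmless. -/
theorem TQO2.mul_localProj_eq_zero {ℓ r : ℕ} (h2 : M.TQO2 ℓ) (hr1 : 1 ≤ r) (hr : r ≤ ℓ)
    (u : Site D L) {O : Op d} (hO : ActsOn (cube r u) O) (hOP : O * M.P = 0) :
    O * M.localProj (cube (r + 2) fun i => u i - 1) = 0 := by
  by_cases hL : r + 2 ≤ L
  · exact h2 r hr1 hr hL u O hO hOP
  · rw [cube_eq_univ (by omega)]
    exact hOP

end ProjectorModel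

open ProjectorModel in
/-- After subtraction of a scalar, the terms of size `r` of a locally block-diagonal Hamiltonian are
bounded relative to `H₀`. -/
theorem LocalHamiltonian.exists_sum_term_bounds {M : ProjectorModel D L d} {ℓ r : ℕ}
    (hP : M.ZeroGroundEnergy) (h1 : M.TQO1 ℓ) (h2 : M.TQO2 ℓ) (hr1 : 1 ≤ r) (hr : r ≤ ℓ)
    (V : LocalHamiltonian D L d) (hV : V.LocallyBlockDiagonal M) {K : ℝ} (hK0 : 0 ≤ K)
    (hK : ∀ A ∈ cubes D L r, ‖V.term r A‖ ≤ K) :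
    ∃ c : ℝ, ∑ A ∈ cubes D L r, V.term r A + c • (1 : Op d) ≤ (2 * K * (r + 2) ^ D) • M.H₀ ∧
      -((2 * K * (r + 2) ^ D) • M.H₀) ≤ ∑ A ∈ cubes D L r, V.term r A + c • (1 : Op d) := by
  have key : ∀ A : Finset (Site D L), ∃ (c : ℝ) (u : Site D L), A ∈ cubes D L r →
      A = cube r u ∧
      V.term r A - c • (1 : Op d) ≤
        (2 * K) • ∑ C ∈ (cubes D L 2).filter (· ⊆ cube (r + 2) fun i => u i - 1), M.Q C ∧
      -(V.term r A - c • (1 : Op d)) ≤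
        (2 * K) • ∑ C ∈ (cubes D L 2).filter (· ⊆ cube (r + 2) fun i => u i - 1), M.Q C := by
    intro A
    by_cases hA : A ∈ cubes D L r
    swap
    · exact ⟨0, 0, fun h => absurd h hA⟩
    obtain ⟨c, hc, hcP⟩ := h1.exists_real_smul hP hr hA (V.actsOn r A hA) (V.isHermitian r A hA)
      (hV r A hA)
    obtain ⟨u, hu⟩ := exists_eq_cube hA
    refine ⟨c, u, fun _ => ⟨hu, ?_⟩⟩
    have hcc : c • (1 : Op d) = (c : ℂ) • 1 := (Complex.coe_smul c (1 : Op d)).symm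
    have hWB := h2.mul_localProj_eq_zero hr1 hr u
      (hu ▸ (V.actsOn r A hA).sub_smul_one (c : ℂ)) hcP
    obtain ⟨hB, hBle⟩ := M.localProj_spec (cube (r + 2) fun i => u i - 1)
    rw [← hcc] at hWB
    set W := V.term r A - c • (1 : Op d)
    have hWs : IsSelfAdjoint W :=
      IsSelfAdjoint.sub (V.isHermitian r A hA) (IsSelfAdjoint.smul (.all c) (.one _))
    have hone : ‖(1 : Op d)‖ ≤ 1 := IsStarProjection.norm_le _ (.one _)
    -- The factor 2 pays for the subtracted scalar, of modulus at most `K`.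
    have hWn : ‖W‖ ≤ 2 * K := by
      calc ‖W‖ ≤ ‖V.term r A‖ + ‖c • (1 : Op d)‖ := norm_sub_le _ _
        _ ≤ K + K * 1 := by
          rw [norm_smul, Real.norm_eq_abs]
          exact add_le_add (hK A hA)
            (mul_le_mul (hc.trans (hK A hA)) hone (norm_nonneg _) hK0)
        _ = 2 * K := by ring
    have hfin : ‖W‖ • (1 - M.localProj (cube (r + 2) fun i => u i - 1)) ≤
        (2 * K) • ∑ C ∈ (cubes D L 2).filter (· ⊆ cube (r + 2) fun i => u i - 1), M.Q C :=
      (smul_le_smul_of_nonneg_right hWn hB.one_sub.nonneg).trans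
        (smul_le_smul_of_nonneg_left hBle (by positivity))
    refine ⟨(IsSelfAdjoint.le_norm_smul_one_sub hWs hB hWB).trans hfin, ?_⟩
    have hneg := IsSelfAdjoint.le_norm_smul_one_sub hWs.neg hB (by rw [neg_mul, hWB, neg_zero])
    rw [norm_neg] at hneg
    exact hneg.trans hfin
  choose c u hcu using key
  have hsum : ∑ A ∈ cubes D L r, (2 * K) • ∑ C ∈ (cubes D L 2).filter
      (· ⊆ cube (r + 2) fun i => u A i - 1), M.Q C ≤ (2 * K * (r + 2) ^ D) • M.H₀ := by
    rw [← Finset.smul_sum, mul_smul (2 * K), H₀]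
    refine smul_le_smul_of_nonneg_left ?_ (mul_nonneg zero_le_two hK0)
    simp_rw [Finset.sum_filter]
    rw [Finset.sum_comm, Finset.smul_sum]
    refine Finset.sum_le_sum fun C hC => ?_
    rw [← Finset.sum_filter, Finset.sum_const, ← Nat.cast_smul_eq_nsmul ℝ]
    refine smul_le_smul_of_nonneg_right ?_ (M.isStarProjection C hC).nonneg
    -- After exchanging the sums, `Q_C` is counted once per `A` whose enlarged cube contains `C`,
    -- hence contains a fixed site `w` of `C`. The corner `u A` determines `A`.
    obtain ⟨w, hw⟩ := nonempty_of_mem_cubes hC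
    have hcard := (Finset.card_le_card_of_injOn u
      (s := (cubes D L r).filter fun A => C ⊆ cube (r + 2) fun i => u A i - 1)
      (t := Finset.univ.filter fun v : Site D L => w ∈ cube (r + 2) fun i => v i - 1)
      (fun A hA => by
        simp only [Finset.coe_filter, Set.mem_ofPred_eq, Finset.mem_univ, true_and] at hA ⊢
        exact hA.2 hw)
      (fun A hA A' hA' h => by
        rw [(hcu A (Finset.mem_filter.1 hA).1).1, (hcu A' (Finset.mem_filter.1 hA').1).1, h])).trans
      (card_filter_mem_cube_le (r + 2) w)
    exact_mod_cast hcard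
  have hsplit : ∑ A ∈ cubes D L r, V.term r A + (-∑ A ∈ cubes D L r, c A) • (1 : Op d) =
      ∑ A ∈ cubes D L r, (V.term r A - c A • (1 : Op d)) := by
    rw [Finset.sum_sub_distrib, neg_smul, Finset.sum_smul, sub_eq_add_neg]
  refine ⟨-∑ A ∈ cubes D L r, c A, ?_, ?_⟩
  · rw [hsplit]
    exact (Finset.sum_le_sum fun A hA => (hcu A hA).2.1).trans hsum
  · rw [hsplit, neg_le, ← Finset.sum_neg_distrib]
    exact (Finset.sum_le_sum fun A hA => (hcu A hA).2.2).trans hsum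

/-! ### Tails of fast decaying functions -/

section Decay

open Filter Topology

theorem FastDecay.summable_pow_mul {f : ℕ → ℝ} (hf : FastDecay f) (k : ℕ) :
    Summable fun r : ℕ => (r : ℝ) ^ k * f r := by
  refine summable_of_isBigO_nat (Real.summable_one_div_nat_pow.2 one_lt_two) ?_
  refine Asymptotics.IsBigO.of_bound 1 ?_
  filter_upwards [(hf (k + 2)).norm.eventually (gt_mem_nhds (by simp : ‖(0 : ℝ)‖ < 1)),
    eventually_gt_atTop 0] with r hr hr0
  have hr0' : (0 : ℝ) < r := Nat.cast_pos.2 hr0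
  rw [Real.norm_of_nonneg (by positivity : (0 : ℝ) ≤ 1 / (r : ℝ) ^ 2), one_mul,
    le_div_iff₀ (by positivity), ← Real.norm_of_nonneg (by positivity : (0 : ℝ) ≤ (r : ℝ) ^ 2),
    ← norm_mul]
  refine le_trans (le_of_eq ?_) hr.le
  congr 1
  ring

/-- The tails of the series of a fast decaying function decay fast, also after multiplication with a
power. -/
theorem FastDecay.pow_mul_tail {f : ℕ → ℝ} (hf : FastDecay f) (h0 : ∀ r, 0 ≤ f r) (m : ℕ) :
    FastDecay fun n => (n : ℝ) ^ m * ∑' r, f (r + (n + 1)) := by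
  intro k
  have hs := hf.summable_pow_mul (k + m)
  have hs0 : Summable f := by simpa using hf.summable_pow_mul 0
  -- As `n ≤ r` in the tail, `n ^ (k + m)` moves inside as `r ^ (k + m)`, leaving the tail of a
  -- convergent series.
  refine squeeze_zero (fun n => ?_) (fun n => ?_)
    ((tendsto_sum_nat_add fun r : ℕ => (r : ℝ) ^ (k + m) * f r).comp (tendsto_add_atTop_nat 1))
  · have : 0 ≤ ∑' r, f (r + (n + 1)) := tsum_nonneg fun r => h0 _
    positivity
  · rw [← mul_assoc, ← pow_add, ← tsum_mul_left]
    refine Summable.tsum_le_tsum (fun r => ?_) (((summable_nat_add_iff (n + 1)).2 hs0).mul_left _)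
      ((summable_nat_add_iff (n + 1)).2 hs)
    refine mul_le_mul_of_nonneg_right (pow_le_pow_left₀ (Nat.cast_nonneg n) ?_ _) (h0 _)
    exact Nat.cast_le.2 (by omega : n ≤ r + (n + 1))

end Decay

/-- A sum of terms of size more than `ℓ` is bounded by the tail of the decay function. -/
theorem LocalHamiltonian.norm_sum_term_le {D L : ℕ} [NeZero L] {d : Site D L → ℕ}
    (V : LocalHamiltonian D L d) {f : ℕ → ℝ} (h0 : ∀ r, 0 ≤ f r) (hs : Summable f) {J : ℝ}
    (hJ : 0 ≤ J) (hV : V.HasStrength f J) (ℓ : ℕ) (s : Finset ℕ) (hsl : ∀ r ∈ s, ℓ < r) :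
    ‖∑ r ∈ s, ∑ A ∈ cubes D L r, V.term r A‖ ≤ J * ((L : ℝ) ^ D * ∑' r, f (r + (ℓ + 1))) := by
  calc ‖∑ r ∈ s, ∑ A ∈ cubes D L r, V.term r A‖
      ≤ ∑ r ∈ s, ∑ A ∈ cubes D L r, ‖V.term r A‖ :=
        norm_sum_le_of_le _ fun r _ => norm_sum_le _ _
    _ ≤ ∑ r ∈ s, (L : ℝ) ^ D * (J * f r) := by
        refine Finset.sum_le_sum fun r _ => ?_
        refine (Finset.sum_le_card_nsmul _ _ _ fun A hA => hV r A hA).trans ?_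
        rw [nsmul_eq_mul]
        exact mul_le_mul_of_nonneg_right (by exact_mod_cast card_cubes_le D L r)
          (mul_nonneg hJ (h0 r))
    _ = J * ((L : ℝ) ^ D * ∑ r ∈ s, f r) := by
        rw [← Finset.mul_sum, ← Finset.mul_sum]; ring
    _ ≤ J * ((L : ℝ) ^ D * ∑' r, f (r + (ℓ + 1))) := by
        refine mul_le_mul_of_nonneg_left (mul_le_mul_of_nonneg_left ?_ (by positivity)) hJ
        have hsub : ∑ r ∈ s, f r = ∑ r ∈ s.image (· - (ℓ + 1)), f (r + (ℓ + 1)) := by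
          rw [Finset.sum_image]
          · refine Finset.sum_congr rfl fun r hr => ?_
            rw [Nat.sub_add_cancel (hsl r hr)]
          · intro x hx y hy hxy
            have := hsl x hx
            have := hsl y hy
            simp only at hxy
            omega
        rw [hsub]
        exact ((summable_nat_add_iff (ℓ + 1)).2 hs).sum_le_tsum _ fun r _ => h0 _

end LatticeTQO

/-! ### Assembling the bounds -/

open scoped MatrixOrder ComplexOrder

open LatticeTQO in
theorem mainTheorem2 (D : ℕ) (hD : 1 ≤ D)
    (f : ℕ → ℝ) (hf01 : ∀ r, 1 ≤ r → f r ∈ Set.Icc (0 : ℝ) 1) (hf : FastDecay f) :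
    ∃ C : ℝ, 0 < C ∧ ∀ a : ℝ, 0 < a →
      ∃ g : ℕ → ℝ, (∀ n, 0 ≤ g n) ∧ FastDecay g ∧
        ∀ (L : ℕ) [NeZero L] (d : Site D L → ℕ) (M : ProjectorModel D L d) (Lstar : ℕ),
          M.ZeroGroundEnergy → (L : ℝ) ^ a ≤ (Lstar : ℝ) → M.TQO1 Lstar → M.TQO2 Lstar →
          ∀ (J : ℝ) (V : LocalHamiltonian D L d), 0 ≤ J →
            V.HasStrength f J → V.LocallyBlockDiagonal M →
            ∃ c : ℝ, spectrum ℝ (M.H₀ + V.total + c • (1 : Op d)) ⊆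
              ⋃ k ∈ spectrum ℝ M.H₀,
                Set.Icc (k * (1 - C * J) - J * g Lstar) (k * (1 + C * J) + J * g Lstar) := by
  -- the value `f 0` is irrelevant
  let F : ℕ → ℝ := fun r => if r = 0 then 0 else f r
  have hFf : ∀ r, 1 ≤ r → F r = f r := fun r hr => if_neg (by omega)
  have hF0 : ∀ r, 0 ≤ F r := by
    intro r
    rcases Nat.eq_zero_or_pos r with rfl | hr
    · simp [F]
    · rw [hFf r hr]
      exact (hf01 r hr).1
  have hF : FastDecay F := Asymptotics.SuperpolynomialDecay.congr' hf (by
    filter_upwards [Filter.eventually_ge_atTop 1] with r hr using (hFf r hr).symm)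
  have hFs : Summable F := by simpa using hF.summable_pow_mul 0
  have hG0 : ∀ r : ℕ, 0 ≤ 2 * F r * ((r : ℝ) + 2) ^ D := fun r => by
    have := hF0 r
    positivity
  have hGs : Summable fun r : ℕ => 2 * F r * ((r : ℝ) + 2) ^ D := by
    refine Summable.of_nonneg_of_le hG0 (fun r => ?_)
      ((hF.summable_pow_mul D).mul_left (2 * 3 ^ D))
    -- The comparison `r + 2 ≤ 3 r` needs `r ≥ 1`; at `0` the value `F 0 = 0` helps.
    rcases Nat.eq_zero_or_pos r with rfl | hr
    · simp [F]
    · have hr' : (1 : ℝ) ≤ r := by exact_mod_cast hr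
      have h3 : ((r : ℝ) + 2) ^ D ≤ (3 * r) ^ D :=
        pow_le_pow_left₀ (by positivity) (by linarith) D
      calc 2 * F r * ((r : ℝ) + 2) ^ D ≤ 2 * F r * (3 * r) ^ D :=
            mul_le_mul_of_nonneg_left h3 (mul_nonneg zero_le_two (hF0 r))
        _ = 2 * 3 ^ D * ((r : ℝ) ^ D * F r) := by rw [mul_pow]; ring
  -- The summand 1 only makes the constant positive.
  refine ⟨1 + ∑' r : ℕ, 2 * F r * ((r : ℝ) + 2) ^ D,
    add_pos_of_pos_of_nonneg one_pos (tsum_nonneg hG0), fun a ha => ?_⟩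
  set C := 1 + ∑' r : ℕ, 2 * F r * ((r : ℝ) + 2) ^ D with hC
  -- With `m * a ≥ D`, the number of cubes satisfies `L ^ D ≤ (L ^ a) ^ m ≤ Lstar ^ m`.
  obtain ⟨m, hm⟩ := exists_nat_ge ((D : ℝ) / a)
  rw [div_le_iff₀ ha] at hm
  refine ⟨fun n => (n : ℝ) ^ m * ∑' r, F (r + (n + 1)), fun n => ?_, hF.pow_mul_tail hF0 m, ?_⟩
  · have : 0 ≤ ∑' r, F (r + (n + 1)) := tsum_nonneg fun r => hF0 _
    positivity
  intro L _ d M ℓ hP hL h1 h2 J V hJ hVJ hV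
  have hVF : V.HasStrength F J := by
    intro r A hA
    have hr : 1 ≤ r := by
      by_contra h
      simp [cubes, h] at hA
    rw [hFf r hr]
    exact hVJ r A hA
  have hL1 : (1 : ℝ) ≤ L := by exact_mod_cast NeZero.one_le
  have hLD : (L : ℝ) ^ D ≤ (ℓ : ℝ) ^ m := by
    calc (L : ℝ) ^ D = (L : ℝ) ^ (D : ℝ) := (Real.rpow_natCast _ _).symm
      _ ≤ (L : ℝ) ^ (m * a) := Real.rpow_le_rpow_of_exponent_le hL1 hm
      _ = ((L : ℝ) ^ a) ^ m := by rw [mul_comm, Real.rpow_mul (by positivity), Real.rpow_natCast]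
      _ ≤ (ℓ : ℝ) ^ m := pow_le_pow_left₀ (by positivity) hL m
  have hbd : ∀ r : ℕ, ∃ c : ℝ, 1 ≤ r → r ≤ ℓ →
      ∑ A ∈ cubes D L r, V.term r A + c • (1 : Op d) ≤
        (2 * (J * F r) * (r + 2) ^ D) • M.H₀ ∧
      -((2 * (J * F r) * (r + 2) ^ D) • M.H₀) ≤
        ∑ A ∈ cubes D L r, V.term r A + c • (1 : Op d) := by
    intro r
    by_cases hr : 1 ≤ r ∧ r ≤ ℓ
    · obtain ⟨c, hc⟩ := V.exists_sum_term_bounds hP h1 h2 hr.1 hr.2 hV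
        (mul_nonneg hJ (hF0 r)) (hVF r)
      exact ⟨c, fun _ _ => hc⟩
    · exact ⟨0, fun h h' => absurd ⟨h, h'⟩ hr⟩
  choose c hc using hbd
  set s := (Finset.Icc 1 L).filter (· ≤ ℓ)
  set t := (Finset.Icc 1 L).filter fun r => ¬ r ≤ ℓ
  have hmem : ∀ r ∈ s, 1 ≤ r ∧ r ≤ ℓ := fun r hr =>
    ⟨(Finset.mem_Icc.1 (Finset.mem_filter.1 hr).1).1, (Finset.mem_filter.1 hr).2⟩
  set W : Op d := ∑ r ∈ s, (∑ A ∈ cubes D L r, V.term r A + c r • (1 : Op d)) with hW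
  set R : Op d := ∑ r ∈ t, ∑ A ∈ cubes D L r, V.term r A with hR
  have hdec : M.H₀ + V.total + (∑ r ∈ s, c r) • (1 : Op d) = M.H₀ + W + R := by
    rw [LocalHamiltonian.total, ← Finset.sum_filter_add_sum_filter_not _ (· ≤ ℓ), hW,
      Finset.sum_add_distrib, Finset.sum_smul]
    abel
  have hsum : (∑ r ∈ s, 2 * (J * F r) * ((r : ℝ) + 2) ^ D) • M.H₀ ≤ (C * J) • M.H₀ := by
    refine smul_le_smul_of_nonneg_right ?_ M.H₀_nonneg
    calc ∑ r ∈ s, 2 * (J * F r) * ((r : ℝ) + 2) ^ D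
        = J * ∑ r ∈ s, 2 * F r * ((r : ℝ) + 2) ^ D := by
          rw [Finset.mul_sum]
          exact Finset.sum_congr rfl fun r _ => by ring
      _ ≤ J * C := mul_le_mul_of_nonneg_left
          ((hGs.sum_le_tsum _ fun r _ => hG0 r).trans (by rw [hC]; linarith)) hJ
      _ = C * J := mul_comm _ _
  have hWhi : W ≤ (C * J) • M.H₀ := by
    refine le_trans ?_ hsum
    rw [Finset.sum_smul]
    exact Finset.sum_le_sum fun r hr => (hc r (hmem r hr).1 (hmem r hr).2).1
  have hWlo : -((C * J) • M.H₀) ≤ W := by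
    refine (neg_le_neg hsum).trans ?_
    rw [Finset.sum_smul, ← Finset.sum_neg_distrib]
    exact Finset.sum_le_sum fun r hr => (hc r (hmem r hr).1 (hmem r hr).2).2
  have hherm : ∀ r, IsSelfAdjoint (∑ A ∈ cubes D L r, V.term r A) := fun r =>
    isSelfAdjoint_sum _ fun A hA => V.isHermitian r A hA
  have hRs : IsSelfAdjoint R := isSelfAdjoint_sum _ fun r _ => hherm r
  have hWs : IsSelfAdjoint W := isSelfAdjoint_sum _ fun r _ =>
    (hherm r).add (IsSelfAdjoint.smul (.all _) (.one _))
  have hRn : ‖R‖ ≤ J * ((ℓ : ℝ) ^ m * ∑' r, F (r + (ℓ + 1))) :=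
    (V.norm_sum_term_le hF0 hFs hJ hVF ℓ t fun r hr =>
      not_le.1 (Finset.mem_filter.1 hr).2).trans
      (mul_le_mul_of_nonneg_left
        (mul_le_mul_of_nonneg_right hLD (tsum_nonneg fun r => hF0 _)) hJ)
  set δ := J * ((ℓ : ℝ) ^ m * ∑' r, F (r + (ℓ + 1)))
  have hδ : ‖R‖ • (1 : Op d) ≤ δ • (1 : Op d) :=
    smul_le_smul_of_nonneg_right hRn zero_le_one
  have hRhi : R ≤ δ • (1 : Op d) := by
    have := hRs.le_algebraMap_norm_self
    rw [Algebra.algebraMap_eq_smul_one] at this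
    exact this.trans hδ
  have hRlo : -(δ • (1 : Op d)) ≤ R := by
    have := hRs.neg_algebraMap_norm_le_self
    rw [Algebra.algebraMap_eq_smul_one] at this
    exact (neg_le_neg hδ).trans this
  refine ⟨∑ r ∈ s, c r, ?_⟩
  rw [hdec]
  refine spectrum_subset_of_le_of_le M.isHermitian_H₀
    (IsSelfAdjoint.add (IsSelfAdjoint.add M.isHermitian_H₀ hWs) hRs) ?_ ?_
  · rw [sub_smul, one_smul, sub_eq_add_neg, sub_eq_add_neg]
    exact add_le_add (add_le_add le_rfl hWlo) hRlo
  · rw [add_smul, one_smul]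
    exact add_le_add (add_le_add le_rfl hWhi) hRhi
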